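/- Let $N$ be a finite set of players, each with actions $\{0,1\}$, and identify an action profile with the set $X\subseteq N$ of players taking action $1$; let $u_i:2^N\to\mathbb R$ be the utility of player $i$. For $X\not\ni i$ put $u_i^*(X)=\max\{u_i(X),u_i(X\cup\{i\})\}$. Assume that for every $i\in N$ and all $X\subsetneq Y\subseteq N\setminus\{i\}$, the stage game $\Gamma=(N,u)$ satisfies: (a) (single crossing) $u_i(X\cup\{i\})\ge u_i(X)$ implies $u_i(Y\cup\{i\})\ge u_i(Y)$, and likewise with $>$ in place of $\ge$; (b) (common interests) $u_i^*(X)\le u_i^*(Y)$, and if $u_i^*(Y)=u_i(Y\cup\{i\})$ and $u_i^*(X)=u_i(X)$ then $u_i^*(Y)>u_i^*(X)$; (c) (deviation-proofness) $u_i(Y\cup\{i\})\ge u_i(X)$ implies $u_i(Y\cup\{i\})\ge u_i(Y)$, and likewise with $>$ in place of $\ge$. Assume also (nobody has a dominant action) that $u_i(N)>u_i(N\setminus\{i\})$ and $u_i(\emptyset)>u_i(\{i\})$ for every $i\in N$. Synchronous game. For $T\ge 1$, in $\Gamma(T)$ all players choose actions simultaneously in stages $1,\dots,T$, observing all earlier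 profiles; a player who has chosen $1$ must choose $1$ in all later stages; payoffs are $u_i$ of the profile of stage $T$. A monotone subgame perfect equilibrium (MSPNE) is a pure subgame perfect Nash equilibrium in which each player's action is weakly increasing in the history (histories of the same length being ordered componentwise). For $X\subseteq N$ let $\tau_\Gamma(X)$ be the least $T\ge1$ such that $X\subseteq Y$ for every MSPNE outcome $Y$ of $\Gamma(T)$. Graphs. Directed graphs on $N$ have no loops. Write $E_i=\{j: j\to i\}$, let $W_G(X)$ be the set of vertices from which some vertex of $X$ can be reached in $G$ (so $X\subseteq W_G(X)$), and let $G|_X$ be the induced subgraph. The tree-depth is defined recursively: $\mathrm{td}(G)=1$ if $G$ has at most one vertex; otherwise $\mathrm{td}(G)=1+\min_i \mathrm{td}(G\setminus i)$ (minimum over the vertices $i$ of $G$) if $G$ is strongly connected, and $\mathrm{td}(G)$ is the maximum of the tree-depths of the strongly connected components of $G$ if it is not. A graph $G$ on $N$ is a sufficient network of $\Gamma$ if $u_i(E_i\cup\{i\})>u_i(E_i)$ for all $i\in N$, and a minimal sufficient network if moreover no graph on $N$ with a strictly smaller edge set is sufficient. A stage game $\Lambda=(N,v)$ is a weakest-link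 game on $G$ if it satisfies (a)-(c) and, for all $i$ and $X\subseteq N\setminus\{i\}$, $v_i(X\cup\{i\})>v_i(X)$ if $E_i\subseteq X$ and $v_i(X\cup\{i\})<v_i(X)$ otherwise. Claim. (1) There exist a minimal sufficient network $G$ of $\Gamma$ and a weakest-link game $\Lambda$ on $G$, in which nobody has a dominant action either, such that for every $X\subseteq N$ both $\tau_\Gamma(X)$ and $\tau_\Lambda(X)$ are well defined (finite) and $$\tau_\Gamma(X)=\tau_\Lambda(X)=\mathrm{td}\bigl(G|_{W_G(X)}\bigr).$$ (2) For every $X\subseteq N$, $$\tau_\Gamma(X)=\min\bigl\{\mathrm{td}\bigl(S|_{W_S(X)}\bigr): S\text{ a minimal sufficient network of }\Gamma\bigr\},$$ where the minimum is attained. -/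

import Mathlib

namespace Coordination

/-! ## Stage games

An action profile in `{0,1}^N` is identified with the set of players who take action `1`; the product
order on profiles is then inclusion.  A profile `a_{-i}` of the opponents of `i` is a set `X` with
`i ∉ X`; then `X` stands for `(a_i = 0, a_{-i})` and `insert i X` for `(a_i = 1, a_{-i})`. -/

/-- A stage game with binary actions: `u i X` is the utility of player `i` when exactly the
players in `X` take action `1`. -/
structure StageGame (N : Type*) where
  u : N → Finset N → ℝ

namespace StageGame

variable {N : Type*} [DecidableEq N]

/-- `u_i(1, a_{-i})` weakly (strictly) above `u_i(0, a_{-i})` stays so when `a_{-i}` rises. -/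
def SingleCrossing (Γ : StageGame N) : Prop :=
  ∀ (i : N) (X Y : Finset N), i ∉ Y → X ⊂ Y →
    (Γ.u i X ≤ Γ.u i (insert i X) → Γ.u i Y ≤ Γ.u i (insert i Y)) ∧
    (Γ.u i X < Γ.u i (insert i X) → Γ.u i Y < Γ.u i (insert i Y))

/-- `u_i^*(a_{-i})`, the best-response value, for `i ∉ X`. -/
noncomputable def bestValue (Γ : StageGame N) (i : N) (X : Finset N) : ℝ :=
  max (Γ.u i X) (Γ.u i (insert i X))

/-- The best-response value is non-decreasing in `a_{-i}`, and strictly increases whenever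
action `1` is optimal at the higher and action `0` at the lower opponents' profile. -/
def CommonInterests (Γ : StageGame N) : Prop :=
  ∀ (i : N) (X Y : Finset N), i ∉ Y → X ⊂ Y →
    Γ.bestValue i X ≤ Γ.bestValue i Y ∧
    (Γ.bestValue i Y = Γ.u i (insert i Y) → Γ.bestValue i X = Γ.u i X →
      Γ.bestValue i X < Γ.bestValue i Y)

/-- The deviation-proof condition. -/
def DeviationProof (Γ : StageGame N) : Prop :=
  ∀ (i : N) (X Y : Finset N), i ∉ Y → X ⊂ Y →
    (Γ.u i X ≤ Γ.u i (insert i Y) → Γ.u i Y ≤ Γ.u i (insert i Y)) ∧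
    (Γ.u i X < Γ.u i (insert i Y) → Γ.u i Y < Γ.u i (insert i Y))

/-- The standing assumptions on stage games. -/
structure IsCoordination (Γ : StageGame N) : Prop where
  singleCrossing : Γ.SingleCrossing
  commonInterests : Γ.CommonInterests
  deviationProof : Γ.DeviationProof

/-- Nobody has a dominant action: `1` is the strict best reply if everybody else plays `1`,
and `0` is the strict best reply if everybody else plays `0`. -/
def NonDegenerate [Fintype N] (Γ : StageGame N) : Prop :=
  ∀ i : N, Γ.u i (Finset.univ.erase i) < Γ.u i Finset.univ ∧ Γ.u i {i} < Γ.u i ∅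

end StageGame

/-! ## The synchronous game

A history is the list of the action profiles chosen so far, the most recent one first. -/

section Synchronous

variable {N : Type*}

/-- The most recent profile of a history (nobody has committed at the empty history). -/
def lastProfile : List (Finset N) → Finset N
  | [] => ∅
  | a :: _ => a

/-- Histories obey irreversibility: every profile contains all earlier ones. -/
def IsHistory (h : List (Finset N)) : Prop :=
  h.Pairwise (fun later earlier => earlier ⊆ later)

/-- A pure strategy tells a player at each history whether to take action `1`.  Only the values
at histories of length `< T` matter in the `T`-stage game. -/
abbrev Strategy (N : Type*) := List (Finset N) → Bool

/-- The irreversibility constraint on a strategy of player `i` in the `T`-stage game. -/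
def IsIrreversible (T : ℕ) (i : N) (σ : Strategy N) : Prop :=
  ∀ h : List (Finset N), IsHistory h → h.length < T → i ∈ lastProfile h → σ h = true

variable [Fintype N]

/-- The profile chosen at history `h` under the strategy profile `s`. -/
def jointAction (s : N → Strategy N) (h : List (Finset N)) : Finset N :=
  Finset.univ.filter (fun i => s i h = true)

/-- The history reached from `h` after `n` more stages of play according to `s`. -/
def play (s : N → Strategy N) : ℕ → List (Finset N) → List (Finset N)
  | 0, h => h
  | n + 1, h => play s n (jointAction s h :: h)

/-- The profile played at stage `T` if `s` is followed from the history `h` on. -/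
def outcomeFrom (T : ℕ) (s : N → Strategy N) (h : List (Finset N)) : Finset N :=
  lastProfile (play s (T - h.length) h)

/-- A strategy is monotonic in history: among histories of equal length, ordered
stage by stage, a higher history leads to a weakly higher action. -/
def IsMonotonic (T : ℕ) (σ : Strategy N) : Prop :=
  ∀ h h' : List (Finset N), IsHistory h → IsHistory h' → h.length < T →
    List.Forall₂ (fun a b => a ⊆ b) h h' → σ h = true → σ h' = true

variable [DecidableEq N]

/-- Pure subgame perfect Nash equilibria of the synchronous game with `T` stages: in the subgame
after any history of length `< T`, no player gains by switching to another strategy. -/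
structure IsSPNE (Γ : StageGame N) (T : ℕ) (s : N → Strategy N) : Prop where
  irreversible : ∀ i, IsIrreversible T i (s i)
  noDeviation : ∀ h : List (Finset N), IsHistory h → h.length < T →
    ∀ (i : N) (σ : Strategy N), IsIrreversible T i σ →
      Γ.u i (outcomeFrom T (Function.update s i σ) h) ≤ Γ.u i (outcomeFrom T s h)

/-- `O(Γ(T))`: the outcomes of the monotone subgame perfect equilibria of the `T`-stage game. -/
def outcomes (Γ : StageGame N) (T : ℕ) : Set (Finset N) :=
  {Y | ∃ s : N → Strategy N, IsSPNE Γ T s ∧ (∀ i, IsMonotonic T (s i)) ∧ outcomeFrom T s [] = Y}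

/-- The numbers `T ≥ 1` of stages such that all players in `X` take action `1` in every monotone
subgame perfect equilibrium of the `T`-stage game. -/
def coordinationTimes (Γ : StageGame N) (X : Finset N) : Set ℕ :=
  {T | 1 ≤ T ∧ ∀ Y ∈ outcomes Γ T, X ⊆ Y}

/-- `τ_Γ(X)`, the least element of `coordinationTimes Γ X`. -/
noncomputable def tau (Γ : StageGame N) (X : Finset N) : ℕ :=
  sInf (coordinationTimes Γ X)

end Synchronous

/-! ## Directed graphs

`G.Adj j i` is the edge `j → i`.  The induced subgraph `G|_X` is represented by the pair `(G, X)`. -/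

section Graphs

variable {N : Type*}

/-- No edges from a vertex to itself. -/
def NoLoops (G : Digraph N) : Prop := ∀ i, ¬ G.Adj i i

/-- `j` can reach `i` along a (possibly trivial) directed path inside `G|_X`. -/
def ReachesIn (G : Digraph N) (X : Finset N) (j i : N) : Prop :=
  Relation.ReflTransGen (fun a b => a ∈ X ∧ b ∈ X ∧ G.Adj a b) j i

/-- `G|_X` is strongly connected. -/
def StronglyConnected (G : Digraph N) (X : Finset N) : Prop :=
  ∀ i ∈ X, ∀ j ∈ X, ReachesIn G X j i

/-- `G|_C` is a strongly connected component of `G|_X`. -/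
def IsComponent (G : Digraph N) (X C : Finset N) : Prop :=
  Maximal (fun D : Finset N => D ⊆ X ∧ D.Nonempty ∧ StronglyConnected G D) C

open Classical in
/-- Tree-depth of `G|_X`: it is `1` if there is at most one vertex; otherwise one plus the minimum
over all vertex deletions if `G|_X` is strongly connected, and the maximum over the strongly
connected components (which are then proper subsets of `X`) if it is not. -/
noncomputable def treeDepth (G : Digraph N) (X : Finset N) : ℕ :=
  if hX : X.card ≤ 1 then 1
  else if StronglyConnected G X then
    1 + X.attach.inf' (Finset.attach_nonempty_iff.mpr (Finset.card_pos.mp (by omega)))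
      (fun i => treeDepth G (X.erase i.1))
  else
    (X.ssubsets.filter (IsComponent G X)).attach.sup (fun C => treeDepth G C.1)
termination_by X.card
decreasing_by
  · exact Finset.card_erase_lt_of_mem i.2
  · exact Finset.card_lt_card (Finset.mem_ssubsets.mp (Finset.mem_filter.mp C.2).1)

variable [Fintype N]

open Classical in
/-- `E_i`, the in-neighbours of `i`. -/
noncomputable def inNeighbors (G : Digraph N) (i : N) : Finset N :=
  Finset.univ.filter (fun j => G.Adj j i)

open Classical in
/-- `W(X)`, the vertices from which some vertex of `X` can be reached (including `X` itself). -/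
noncomputable def ancestors (G : Digraph N) (X : Finset N) : Finset N :=
  Finset.univ.filter (fun j => ∃ i ∈ X, Relation.ReflTransGen G.Adj j i)

variable [DecidableEq N]

/-- A weakest link game on `G`: a coordination stage game in which action `1` is strictly better if
all in-neighbours take action `1`, and strictly worse otherwise. -/
structure IsWeakestLink (Λ : StageGame N) (G : Digraph N) : Prop where
  isCoordination : Λ.IsCoordination
  noLoops : NoLoops G
  better : ∀ (i : N) (X : Finset N), i ∉ X → inNeighbors G i ⊆ X → Λ.u i X < Λ.u i (insert i X)
  worse : ∀ (i : N) (X : Finset N), i ∉ X → ¬ inNeighbors G i ⊆ X → Λ.u i (insert i X) < Λ.u i X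

/-- A sufficient network: every player strictly prefers action `1` if exactly the
in-neighbours take action `1`. -/
def IsSufficient (Γ : StageGame N) (G : Digraph N) : Prop :=
  NoLoops G ∧ ∀ i, Γ.u i (inNeighbors G i) < Γ.u i (insert i (inNeighbors G i))

/-- A minimal sufficient network: no proper spanning subgraph is sufficient. -/
def IsMinimalSufficient (Γ : StageGame N) (G : Digraph N) : Prop :=
  Minimal (IsSufficient Γ) G

end Graphs

end Coordination

/-!
Let `Γ.Wants i X` say that action `1` is strictly better than action `0` for `i` when, among the
others, exactly the members of `X` take action `1`; by single crossing this is monotone in `X`.  How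
fast players coordinate depends on these incentives only.  For a monotone family `P` of incentives put
`reach P 0 A = A`, and let `reach P (t + 1) A` be the least `X ⊇ A` such that
`P i (reach P t (insert i X))` fails for all `i ∉ X`.

*Equilibria.*  With `P = Γ.Wants`, the set `reach P T ∅` is the least outcome of a monotone
equilibrium (`isLeast_outcomes`).  If `Z` is the outcome from a history with `t + 1` stages left and
`i ∉ Z`, then `i` can commit at once.  The strategies being monotone, the play that follows ends in
some `Z' ⊇ insert i Z`, which by induction is a fixed point of `reach P t` and so contains
`reach P t (insert i Z)`.  If `i` wanted action `1` there, then also at `Z'`, and by common interests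
the commitment would pay; hence `Z` is a fixed point of `reach P (t + 1)` (`stable_outcomeFrom`).
Conversely, it is an equilibrium that everybody in `reach P t A` commits immediately, when `A` is the
set of committed players and `t` stages remain; deviation-proofness excludes that an outsider gains
by committing (`isSPNE_reachStrategy`).  So `X` coordinates within `T` stages if and only if
`X ⊆ reach Γ.Wants T ∅`.

*Networks.*  In a weakest-link game on `G` the incentive of `i` is `inNeighbors G i ⊆ X`, and
`subset_reach_iff_treeDepth_le` shows that an ancestor-closed set is reached within `t ≥ 1` stages if
and only if its tree-depth is at most `t`: the recursion for `reach` unravels a strongly connected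
set by letting one vertex commit, as the recursion for tree-depth deletes one.

*From games to networks.*  A sufficient network records only a part of the incentives, so
coordination on it is never faster than in `Γ`.  In the other direction, the construction of
`reach Γ.Wants t ∅` uses, for each player `i`, the incentive of `i` at a single set `E i`, namely at
the profile that `i` foresees when committing, and the same `E i` serve for all `t`
(`exists_support`).  Shrinking each `E i` to a minimal set on which `i` wants to act gives the
in-neighbourhoods of a minimal sufficient network on which coordination is exactly as fast as in `Γ`
(`exists_network`).
-/

namespace Coordination

/-! ### The closure operators of a monotone family of incentives -/

section Reach

variable {N : Type*} [Fintype N] [DecidableEq N]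

open Classical in
/-- Let `P i X` say that player `i` strictly gains from action `1` when the players in `X` end up with
action `1`.  Then `reach P t A` is what coordination must at least achieve when `t` stages remain and
the players in `A` are committed: the least `X ⊇ A` such that no `i ∉ X` can commit now and thereby
trigger, with `t - 1` stages remaining, a final profile that makes action `1` worthwhile for `i`. -/
noncomputable def reach (P : N → Finset N → Prop) : ℕ → Finset N → Finset N
  | 0, A => A
  | t + 1, A => Finset.univ.filter (fun j => ∀ X : Finset N, A ⊆ X →
      (∀ i, i ∉ X → ¬ P i (reach P t (insert i X))) → j ∈ X)

/-- `X` is a fixed point of `reach P (t + 1)`. -/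
def Stable (P : N → Finset N → Prop) (t : ℕ) (X : Finset N) : Prop :=
  ∀ i, i ∉ X → ¬ P i (reach P t (insert i X))

variable {P Q : N → Finset N → Prop}

lemma mem_reach_succ {t : ℕ} {A : Finset N} {j : N} :
    j ∈ reach P (t + 1) A ↔ ∀ X, A ⊆ X → Stable P t X → j ∈ X := by
  simp [reach, Stable]

lemma subset_reach (t : ℕ) (A : Finset N) : A ⊆ reach P t A := by
  cases t with
  | zero => exact subset_rfl
  | succ t => exact fun j hj => mem_reach_succ.2 fun X hX _ => hX hj

lemma reach_mono (t : ℕ) {A B : Finset N} (h : A ⊆ B) : reach P t A ⊆ reach P t B := by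
  cases t with
  | zero => exact h
  | succ t => exact fun j hj => mem_reach_succ.2 fun X hX hs =>
      mem_reach_succ.1 hj X (h.trans hX) hs

lemma reach_subset_of_stable {t : ℕ} {A X : Finset N} (h : A ⊆ X) (hX : Stable P t X) :
    reach P (t + 1) A ⊆ X :=
  fun _ hj => mem_reach_succ.1 hj X h hX

lemma stable_reach (hP : ∀ i, Monotone (P i)) (t : ℕ) (A : Finset N) :
    Stable P t (reach P (t + 1) A) := by
  intro i hi hPi
  rw [mem_reach_succ] at hi
  push Not at hi
  obtain ⟨X, hAX, hX, hiX⟩ := hi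
  exact hX i hiX (hP i (reach_mono t
    (Finset.insert_subset_insert i (reach_subset_of_stable hAX hX))) hPi)

lemma reach_succ_eq_of_stable {t : ℕ} {X : Finset N} (hX : Stable P t X) :
    reach P (t + 1) X = X :=
  (reach_subset_of_stable subset_rfl hX).antisymm (subset_reach _ _)

lemma reach_le_succ (hP : ∀ i, Monotone (P i)) (t : ℕ) :
    ∀ A, reach P t A ⊆ reach P (t + 1) A := by
  induction t with
  | zero => exact fun A => subset_reach 1 A
  | succ t ih =>
    exact fun A j hj => mem_reach_succ.2 fun X hX hs =>
      mem_reach_succ.1 hj X hX fun i hi hPi => hs i hi (hP i (ih _) hPi)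

lemma reach_le (hP : ∀ i, Monotone (P i)) {s t : ℕ} (h : s ≤ t) (A : Finset N) :
    reach P s A ⊆ reach P t A := by
  induction t, h using Nat.le_induction with
  | base => exact subset_rfl
  | succ t _ ih => exact ih.trans (reach_le_succ hP t A)

lemma reach_reach (hP : ∀ i, Monotone (P i)) {s t : ℕ} (h : s ≤ t) (A : Finset N) :
    reach P s (reach P t A) = reach P t A := by
  refine subset_antisymm ((reach_le hP h _).trans ?_) (subset_reach _ _)
  cases t with
  | zero => exact subset_rfl
  | succ t => exact (reach_succ_eq_of_stable (stable_reach hP t A)).subset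

lemma reach_subset_reach (hP : ∀ i, Monotone (P i)) {s t : ℕ} (h : s ≤ t) {A B : Finset N}
    (hAB : A ⊆ reach P t B) : reach P s A ⊆ reach P t B :=
  (reach_mono s hAB).trans (reach_reach hP h B).subset

/-- Everybody who joins does so willingly: otherwise removing the player would leave a smaller
stable set. -/
lemma of_mem_reach (hP : ∀ i, Monotone (P i)) {t : ℕ} {A : Finset N} {i : N}
    (hi : i ∈ reach P t A) (hA : i ∉ A) : P i (reach P t A) := by
  cases t with
  | zero => exact absurd hi hA
  | succ t =>
    by_contra hn
    have hst : Stable P t ((reach P (t + 1) A).erase i) := by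
      intro j hj hPj
      by_cases hji : j = i
      · subst hji
        rw [Finset.insert_erase hi, reach_reach hP (Nat.le_succ t)] at hPj
        exact hn hPj
      · have hj' : j ∉ reach P (t + 1) A := fun h => hj (Finset.mem_erase.2 ⟨hji, h⟩)
        exact stable_reach hP t A j hj' (hP j (reach_mono t
          (Finset.insert_subset_insert j (Finset.erase_subset _ _))) hPj)
    exact Finset.notMem_erase i _ (reach_subset_of_stable
      (Finset.subset_erase.2 ⟨subset_reach _ _, hA⟩) hst hi)

lemma reach_mono_pred (hQ : ∀ i, Monotone (Q i)) (h : ∀ i X, P i X → Q i X) (t : ℕ) :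
    ∀ A, reach P t A ⊆ reach Q t A := by
  induction t with
  | zero => exact fun A => subset_rfl
  | succ t ih =>
    exact fun A j hj => mem_reach_succ.2 fun X hX hs =>
      mem_reach_succ.1 hj X hX fun i hi hPi => hs i hi (hQ i (ih _) (h i _ hPi))

lemma reach_eq_univ (hP : ∀ i, Monotone (P i)) (hU : ∀ i, P i Finset.univ) (t : ℕ) :
    ∀ A : Finset N, Aᶜ.card ≤ t → reach P t A = Finset.univ := by
  induction t with
  | zero =>
    intro A hA
    simpa [reach] using hA
  | succ t ih =>
    intro A hA
    refine Finset.eq_univ_of_forall fun i => ?_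
    by_contra hi
    refine stable_reach hP t A i hi ?_
    rw [ih _ ?_]
    · exact hU i
    have h1 : (insert i (reach P (t + 1) A))ᶜ ⊂ Aᶜ := by
      rw [Finset.compl_ssubset_compl]
      exact Finset.ssubset_of_subset_of_ssubset (subset_reach (P := P) (t + 1) A)
        (Finset.ssubset_insert hi)
    have := Finset.card_lt_card h1
    omega

/-! ### Thinning out the incentives to a network -/

/-- The players reached from `A` can be reached using one set `E i` per player `i`, on which `i` is
willing to act: it suffices that `i` acts whenever `E i` does. -/
lemma exists_support_from (hP : ∀ i, Monotone (P i)) (t : ℕ) :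
    ∀ A : Finset N, ∃ E : N → Finset N, (∀ i ∈ reach P t A, i ∉ A → P i (E i)) ∧
      ∀ Q : N → Finset N → Prop, (∀ i, Monotone (Q i)) →
        (∀ i ∈ reach P t A, i ∉ A → Q i (E i)) → reach P t A ⊆ reach Q t A := by
  induction t with
  | zero => exact fun A => ⟨fun _ => ∅, fun i hi hn => absurd hi hn, fun Q _ _ => subset_rfl⟩
  | succ t ih =>
    intro A
    -- A largest set `X` that can be reached this way turns out to be all of `reach P (t + 1) A`.
    let good : Finset N → Prop := fun X => A ⊆ X ∧ X ⊆ reach P (t + 1) A ∧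
      ∃ E : N → Finset N, (∀ i ∈ X, i ∉ A → P i (E i)) ∧
        ∀ Q : N → Finset N → Prop, (∀ i, Monotone (Q i)) →
          (∀ i ∈ X, i ∉ A → Q i (E i)) → X ⊆ reach Q (t + 1) A
    have hA : good A := ⟨subset_rfl, subset_reach _ _, fun _ => ∅,
      fun i hi hn => absurd hi hn, fun Q _ _ => subset_reach _ _⟩
    obtain ⟨X, -, hX⟩ := Finite.exists_le_maximal hA
    obtain ⟨⟨hAX, hXr, E, hE, hEQ⟩, hmax⟩ := hX
    suffices h : X = reach P (t + 1) A by
      rw [← h]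
      exact ⟨E, hE, hEQ⟩
    by_contra hne
    have hns : ¬ Stable P t X := fun hs => hne (hXr.antisymm (reach_subset_of_stable hAX hs))
    unfold Stable at hns
    push Not at hns
    obtain ⟨i, hiX, hPi⟩ := hns
    obtain ⟨E', hE', hEQ'⟩ := ih (insert i X)
    set Y := reach P t (insert i X) with hY
    have hiXY : insert i X ⊆ Y := subset_reach _ _
    have hXY : X ⊆ Y := (Finset.subset_insert _ _).trans hiXY
    have hir : i ∈ reach P (t + 1) A := by
      by_contra hi
      exact stable_reach hP t A i hi (hP i (reach_mono t (Finset.insert_subset_insert i hXr)) hPi)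
    have hYr : Y ⊆ reach P (t + 1) A :=
      reach_subset_reach hP (Nat.le_succ t) (Finset.insert_subset hir hXr)
    have hgood : good Y := by
      refine ⟨hAX.trans hXY, hYr,
        fun j => if j ∈ X then E j else if j = i then Y else E' j, ?_, ?_⟩
      · intro j hj hjA
        dsimp only
        split_ifs with h1 h2
        · exact hE j h1 hjA
        · exact h2 ▸ hPi
        · exact hE' j hj (by simp [h1, h2])
      · intro Q hQ hQE
        have hXQ : X ⊆ reach Q (t + 1) A := hEQ Q hQ fun j hj hjA => by
          simpa [hj] using hQE j (hXY hj) hjA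
        have hYQ : Y ⊆ reach Q t (insert i X) := hEQ' Q hQ fun j hj hjn => by
          simp only [Finset.mem_insert, not_or] at hjn
          simpa [hjn.1, hjn.2] using hQE j hj fun h => hjn.2 (hAX h)
        have hQi : Q i Y := by
          simpa [hiX] using hQE i (hiXY (Finset.mem_insert_self _ _)) fun h => hiX (hAX h)
        have hiQ : i ∈ reach Q (t + 1) A := by
          by_contra hi
          exact stable_reach hQ t A i hi (hQ i (hYQ.trans
            (reach_mono t (Finset.insert_subset_insert i hXQ))) hQi)
        exact hYQ.trans
          (reach_subset_reach hQ (Nat.le_succ t) (Finset.insert_subset hiQ hXQ))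
    exact hiX (hmax hgood hXY (hiXY (Finset.mem_insert_self _ _)))

/-- One choice of supporting sets works for all numbers of stages at the same time. -/
lemma exists_support (hP : ∀ i, Monotone (P i)) (hU : ∀ i, P i Finset.univ) :
    ∃ E : N → Finset N, (∀ i, P i (E i)) ∧
      ∀ Q : N → Finset N → Prop, (∀ i, Monotone (Q i)) → (∀ i, Q i (E i)) →
        ∀ t, reach P t ∅ ⊆ reach Q t ∅ := by
  have key : ∀ t, ∃ E : N → Finset N, (∀ i ∈ reach P t ∅, P i (E i)) ∧
      ∀ Q : N → Finset N → Prop, (∀ i, Monotone (Q i)) → (∀ i ∈ reach P t ∅, Q i (E i)) →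
        ∀ s ≤ t, reach P s ∅ ⊆ reach Q s ∅ := by
    intro t
    induction t with
    | zero =>
      refine ⟨fun _ => ∅, fun i hi => absurd hi (Finset.notMem_empty i), fun Q _ _ s hs => ?_⟩
      obtain rfl : s = 0 := by omega
      exact subset_rfl
    | succ t ih =>
      obtain ⟨E, hE, hEQ⟩ := ih
      obtain ⟨E', hE', hEQ'⟩ := exists_support_from hP (t + 1) (reach P t ∅)
      have hle := reach_le_succ hP t ∅
      have heq : reach P (t + 1) (reach P t ∅) = reach P (t + 1) ∅ :=
        (reach_subset_reach hP le_rfl hle).antisymm (reach_mono _ (Finset.empty_subset _))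
      rw [heq] at hE' hEQ'
      refine ⟨fun i => if i ∈ reach P t ∅ then E i else E' i, ?_, ?_⟩
      · intro i hi
        dsimp only
        split_ifs with h
        · exact hE i h
        · exact hE' i hi h
      · intro Q hQ hQE s hs
        have h1 := hEQ Q hQ fun i hi => by simpa [hi] using hQE i (hle hi)
        rcases Nat.lt_or_eq_of_le hs with hs | rfl
        · exact h1 s (by omega)
        · exact (hEQ' Q hQ fun i hi hn => by simpa [hn] using hQE i hi).trans
            (reach_subset_reach hQ le_rfl ((h1 t le_rfl).trans (reach_le_succ hQ t ∅)))
  obtain ⟨E, hE, hEQ⟩ := key (Fintype.card N)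
  have hu : reach P (Fintype.card N) ∅ = Finset.univ := reach_eq_univ hP hU _ _ (by simp)
  rw [hu] at hE
  refine ⟨E, fun i => hE i (Finset.mem_univ i), fun Q hQ hQE t => ?_⟩
  have h := hEQ Q hQ fun i _ => hQE i
  rcases le_total t (Fintype.card N) with ht | ht
  · exact h t ht
  · exact (Finset.subset_univ _).trans
      (hu ▸ (h _ le_rfl).trans (reach_le hQ ht ∅))

end Reach

/-! ### Incentives in a coordination game -/

section Game

variable {N : Type*} [DecidableEq N]

/-- Player `i` strictly prefers action `1` when exactly the players in `X \ {i}` among the others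
take it. -/
def StageGame.Wants (Γ : StageGame N) (i : N) (X : Finset N) : Prop :=
  Γ.u i (X.erase i) < Γ.u i (insert i X)

variable {Γ : StageGame N}

lemma StageGame.wants_of_mem {i : N} {X : Finset N} (h : i ∈ X) :
    Γ.Wants i X ↔ Γ.u i (X.erase i) < Γ.u i X := by
  rw [StageGame.Wants, Finset.insert_eq_of_mem h]

lemma StageGame.wants_of_notMem {i : N} {X : Finset N} (h : i ∉ X) :
    Γ.Wants i X ↔ Γ.u i X < Γ.u i (insert i X) := by
  rw [StageGame.Wants, Finset.erase_eq_of_notMem h]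

lemma StageGame.wants_erase {i : N} {X : Finset N} :
    Γ.Wants i (X.erase i) ↔ Γ.Wants i X := by
  by_cases h : i ∈ X
  · simp [StageGame.Wants, Finset.insert_erase h, Finset.insert_eq_of_mem h]
  · rw [Finset.erase_eq_of_notMem h]

lemma StageGame.IsCoordination.monotone_wants (hΓ : Γ.IsCoordination) (i : N) :
    Monotone (Γ.Wants i) := by
  intro X Y hXY h
  rw [← StageGame.wants_erase] at h ⊢
  rcases (Finset.erase_subset_erase i hXY).eq_or_ssubset with he | hs
  · rwa [← he]
  · rw [StageGame.wants_of_notMem (Finset.notMem_erase _ _)] at h ⊢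
    exact (hΓ.singleCrossing i _ _ (Finset.notMem_erase _ _) hs).2 h

/-- If committing leads from `X` to a profile `Z` at which action `1` is optimal, it is profitable.
This is where common interests enter. -/
lemma StageGame.IsCoordination.lt_of_wants (hΓ : Γ.IsCoordination) {i : N} {X Z : Finset N}
    (hi : i ∉ X) (hXZ : insert i X ⊆ Z) (h : Γ.Wants i Z) : Γ.u i X < Γ.u i Z := by
  have hiZ : i ∈ Z := hXZ (Finset.mem_insert_self _ _)
  rw [StageGame.wants_of_mem hiZ] at h
  have hXe : X ⊆ Z.erase i :=
    Finset.subset_erase.2 ⟨(Finset.subset_insert _ _).trans hXZ, hi⟩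
  rcases hXe.eq_or_ssubset with rfl | hs
  · exact h
  · have hci := hΓ.commonInterests i X _ (Finset.notMem_erase _ _) hs
    simp only [StageGame.bestValue, Finset.insert_erase hiZ, max_eq_right h.le] at hci
    rcases le_total (Γ.u i (insert i X)) (Γ.u i X) with hle | hle
    · rw [max_eq_left hle] at hci
      exact hci.2 trivial rfl
    · rcases hle.eq_or_lt with he | hlt
      · rw [← he, max_self] at hci
        exact hci.2 trivial rfl
      · exact hlt.trans_le ((le_max_right _ _).trans hci.1)

/-- If action `1` is not strictly optimal at `Z`, committing at `X` to bring about `Z` does not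
pay. -/
lemma StageGame.IsCoordination.le_of_not_wants (hΓ : Γ.IsCoordination) {i : N} {X Z : Finset N}
    (hi : i ∉ X) (hXZ : insert i X ⊆ Z) (h : ¬ Γ.Wants i Z) : Γ.u i Z ≤ Γ.u i X := by
  have hiZ : i ∈ Z := hXZ (Finset.mem_insert_self _ _)
  rw [StageGame.wants_of_mem hiZ] at h
  have hXe : X ⊆ Z.erase i :=
    Finset.subset_erase.2 ⟨(Finset.subset_insert _ _).trans hXZ, hi⟩
  rcases hXe.eq_or_ssubset with rfl | hs
  · exact not_lt.1 h
  · by_contra hlt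
    have hdp := (hΓ.deviationProof i X _ (Finset.notMem_erase _ _) hs).2
    rw [Finset.insert_erase hiZ] at hdp
    exact h (hdp (not_le.1 hlt))

end Game

/-! ### Play in the synchronous game -/

section Play

variable {N : Type*} {T : ℕ}

lemma IsHistory.cons {h : List (Finset N)} {X : Finset N} (hh : IsHistory h)
    (hX : lastProfile h ⊆ X) : IsHistory (X :: h) := by
  refine List.pairwise_cons.2 ⟨fun a ha => ?_, hh⟩
  cases h with
  | nil => simp at ha
  | cons b l =>
    rcases List.mem_cons.1 ha with rfl | ha
    · exact hX
    · exact ((List.pairwise_cons.1 hh).1 a ha).trans hX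

variable [Fintype N]

lemma mem_jointAction {s : N → Strategy N} {h : List (Finset N)} {i : N} :
    i ∈ jointAction s h ↔ s i h = true := by
  simp [jointAction]

lemma lastProfile_subset_jointAction {s : N → Strategy N} (hs : ∀ i, IsIrreversible T i (s i))
    {h : List (Finset N)} (hh : IsHistory h) (hT : h.length < T) :
    lastProfile h ⊆ jointAction s h :=
  fun i hi => mem_jointAction.2 (hs i h hh hT hi)

lemma outcomeFrom_of_length_eq (s : N → Strategy N) {h : List (Finset N)} (hT : h.length = T) :
    outcomeFrom T s h = lastProfile h := by
  simp [outcomeFrom, hT, play]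

lemma outcomeFrom_cons (s : N → Strategy N) {h : List (Finset N)} (hT : h.length < T) :
    outcomeFrom T s h = outcomeFrom T s (jointAction s h :: h) := by
  have : T - h.length = (T - (h.length + 1)) + 1 := by omega
  rw [outcomeFrom, outcomeFrom, this, play, List.length_cons]

lemma play_congr {s s' : N → Strategy N} (n : ℕ) : ∀ h : List (Finset N),
    (∀ h', h.length ≤ h'.length → jointAction s h' = jointAction s' h') →
      play s n h = play s' n h := by
  induction n with
  | zero => exact fun _ _ => rfl
  | succ n ih =>
    intro h hs
    rw [play, play, hs h le_rfl]
    exact ih _ fun h' hh' => hs h' (by rw [List.length_cons] at hh'; omega)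

lemma lastProfile_subset_outcomeFrom {s : N → Strategy N}
    (hs : ∀ i, IsIrreversible T i (s i)) (r : ℕ) : ∀ h : List (Finset N), IsHistory h →
      h.length + r = T → lastProfile h ⊆ outcomeFrom T s h := by
  induction r with
  | zero => exact fun h _ hr => (outcomeFrom_of_length_eq s hr).symm.subset
  | succ r ih =>
    intro h hh hr
    have hX := lastProfile_subset_jointAction hs hh (by omega)
    rw [outcomeFrom_cons s (by omega)]
    exact hX.trans (ih _ (hh.cons hX) (by rw [List.length_cons]; omega))

lemma outcomeFrom_mono {s : N → Strategy N} (hs : ∀ i, IsIrreversible T i (s i))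
    (hm : ∀ i, IsMonotonic T (s i)) (r : ℕ) : ∀ h h' : List (Finset N), IsHistory h →
      IsHistory h' → h.length + r = T → List.Forall₂ (fun a b => a ⊆ b) h h' →
        outcomeFrom T s h ⊆ outcomeFrom T s h' := by
  induction r with
  | zero =>
    intro h h' _ _ hr hle
    rw [outcomeFrom_of_length_eq s hr, outcomeFrom_of_length_eq s (hle.length_eq ▸ hr)]
    cases hle with
    | nil => exact subset_rfl
    | cons hab _ => exact hab
  | succ r ih =>
    intro h h' hh hh' hr hle
    have hlen := hle.length_eq
    rw [outcomeFrom_cons s (h := h) (by omega), outcomeFrom_cons s (h := h') (by omega)]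
    refine ih _ _ (hh.cons (lastProfile_subset_jointAction hs hh (by omega)))
      (hh'.cons (lastProfile_subset_jointAction hs hh' (by omega)))
      (by rw [List.length_cons]; omega) (List.Forall₂.cons ?_ hle)
    exact fun i hi => mem_jointAction.2
      (hm i h h' hh hh' (by omega) hle (mem_jointAction.1 hi))

end Play

/-! ### Monotone equilibria and the closure operators -/

section Equilibrium

variable {N : Type*} [Fintype N] [DecidableEq N] {Γ : StageGame N} {T : ℕ}

/-- A player outside the outcome of a monotone equilibrium could commit right away; by monotonicity
nobody would then do less than on the original path, and the continuation, being an equilibrium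
outcome itself, would contain everybody who can be reached from there. -/
lemma stable_outcomeFrom (hΓ : Γ.IsCoordination) {s : N → Strategy N} (hs : IsSPNE Γ T s)
    (hm : ∀ i, IsMonotonic T (s i)) (r : ℕ) : ∀ h : List (Finset N), IsHistory h →
      h.length + r = T → reach Γ.Wants r (outcomeFrom T s h) = outcomeFrom T s h := by
  induction r with
  | zero => exact fun _ _ _ => rfl
  | succ r ih =>
    intro h hh hr
    have hT : h.length < T := by omega
    refine reach_succ_eq_of_stable fun i hi hw => ?_
    have hX := lastProfile_subset_jointAction hs.irreversible hh hT
    set Z := outcomeFrom T s h with hZ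
    set X := jointAction s h with hXdef
    have hhX : IsHistory (insert i X :: h) := hh.cons (hX.trans (Finset.subset_insert _ _))
    have hlen : (insert i X :: h).length + r = T := by rw [List.length_cons]; omega
    set Z' := outcomeFrom T s (insert i X :: h) with hZ'
    have hiZ' : i ∈ Z' := lastProfile_subset_outcomeFrom hs.irreversible r _ hhX hlen
      (Finset.mem_insert_self _ _)
    have hZZ' : Z ⊆ Z' := by
      rw [hZ, outcomeFrom_cons s hT]
      refine outcomeFrom_mono hs.irreversible hm r _ _ (hh.cons hX) hhX
        (by rw [List.length_cons]; omega) (List.Forall₂.cons (Finset.subset_insert _ _) ?_)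
      exact List.forall₂_same.2 fun _ _ => subset_rfl
    have hins : insert i Z ⊆ Z' := Finset.insert_subset hiZ' hZZ'
    have hwZ' : Γ.Wants i Z' :=
      hΓ.monotone_wants i ((reach_mono r hins).trans (ih _ hhX hlen).subset) hw
    let σ : Strategy N := fun h' => if h' = h then true else s i h'
    have hσ : IsIrreversible T i σ := by
      intro h' hh' hT' hi'
      dsimp only [σ]
      split_ifs with he
      · rfl
      · exact hs.irreversible i h' hh' hT' hi'
    have hj : jointAction (Function.update s i σ) h = insert i X := by
      ext j
      rw [Finset.mem_insert, mem_jointAction, hXdef, mem_jointAction]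
      by_cases hji : j = i
      · subst hji
        simp [σ]
      · simp [hji]
    have hout : outcomeFrom T (Function.update s i σ) h = Z' := by
      rw [outcomeFrom_cons _ hT, hj, hZ', outcomeFrom, outcomeFrom]
      congr 1
      refine play_congr _ _ fun h' hh' => ?_
      have hne : h' ≠ h := by
        rintro rfl
        rw [List.length_cons] at hh'
        omega
      ext j
      rw [mem_jointAction, mem_jointAction]
      by_cases hji : j = i
      · subst hji
        simp [σ, hne]
      · simp [hji]
    have := hs.noDeviation h hh hT i σ hσ
    rw [hout] at this
    exact absurd (hΓ.lt_of_wants hi hins hwZ') (not_lt.2 this)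

open Classical in
/-- The strategies by which everybody who can be reached commits at once. -/
noncomputable def reachStrategy (P : N → Finset N → Prop) (T : ℕ) : N → Strategy N :=
  fun i h => decide (i ∈ reach P (T - h.length) (lastProfile h))

lemma jointAction_reachStrategy (P : N → Finset N → Prop) (T : ℕ) (h : List (Finset N)) :
    jointAction (reachStrategy P T) h = reach P (T - h.length) (lastProfile h) := by
  ext i
  simp [mem_jointAction, reachStrategy]

lemma isIrreversible_reachStrategy (P : N → Finset N → Prop) (i : N) :
    IsIrreversible T i (reachStrategy P T i) := by
  intro h _ _ hi
  simpa [reachStrategy] using subset_reach _ _ hi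

lemma isMonotonic_reachStrategy (P : N → Finset N → Prop) (i : N) :
    IsMonotonic T (reachStrategy P T i) := by
  intro h h' _ _ _ hle hi
  have hlast : lastProfile h ⊆ lastProfile h' := by
    cases hle with
    | nil => exact subset_rfl
    | cons hab _ => exact hab
  simp only [reachStrategy, decide_eq_true_eq, ← hle.length_eq] at hi ⊢
  exact reach_mono _ hlast hi

/-- A deviator who is already committed changes nothing. -/
lemma outcomeFrom_update_of_mem {P : N → Finset N → Prop} (hP : ∀ i, Monotone (P i)) {i : N}
    {σ : Strategy N} (hσ : IsIrreversible T i σ) (r : ℕ) : ∀ h : List (Finset N),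
      IsHistory h → h.length + r = T → i ∈ lastProfile h →
        outcomeFrom T (Function.update (reachStrategy P T) i σ) h =
          reach P r (lastProfile h) := by
  induction r with
  | zero => exact fun h _ hr _ => outcomeFrom_of_length_eq _ hr
  | succ r ih =>
    intro h hh hr hi
    have hT : h.length < T := by omega
    have hj : jointAction (Function.update (reachStrategy P T) i σ) h =
        reach P (r + 1) (lastProfile h) := by
      rw [show r + 1 = T - h.length by omega, ← jointAction_reachStrategy]
      ext j
      rw [mem_jointAction, mem_jointAction]
      by_cases hji : j = i
      · subst hji
        simp [hσ h hh hT hi, isIrreversible_reachStrategy P j h hh hT hi]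
      · simp [hji]
    have hsub : lastProfile h ⊆ reach P (r + 1) (lastProfile h) := subset_reach _ _
    rw [outcomeFrom_cons _ hT, hj, ih _ (hh.cons hsub) (by rw [List.length_cons]; omega)
      (hsub hi)]
    exact reach_reach hP (Nat.le_succ r) _

lemma outcomeFrom_reachStrategy {P : N → Finset N → Prop} (hP : ∀ i, Monotone (P i)) (r : ℕ) :
    ∀ h : List (Finset N), IsHistory h → h.length + r = T →
      outcomeFrom T (reachStrategy P T) h = reach P r (lastProfile h) := by
  induction r with
  | zero => exact fun h _ hr => outcomeFrom_of_length_eq _ hr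
  | succ r ih =>
    intro h hh hr
    have hsub : lastProfile h ⊆ reach P (r + 1) (lastProfile h) := subset_reach _ _
    rw [outcomeFrom_cons _ (by omega), jointAction_reachStrategy,
      show T - h.length = r + 1 by omega, ih _ (hh.cons hsub) (by rw [List.length_cons]; omega)]
    exact reach_reach hP (Nat.le_succ r) _

lemma u_outcomeFrom_update_le (hΓ : Γ.IsCoordination) {i : N} {σ : Strategy N}
    (hσ : IsIrreversible T i σ) (r : ℕ) : ∀ h : List (Finset N), IsHistory h →
      h.length + r = T →
        Γ.u i (outcomeFrom T (Function.update (reachStrategy Γ.Wants T) i σ) h) ≤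
          Γ.u i (reach Γ.Wants r (lastProfile h)) := by
  have hP := hΓ.monotone_wants
  induction r with
  | zero =>
    intro h _ hr
    rw [outcomeFrom_of_length_eq _ hr]
    exact le_rfl
  | succ r ih =>
    intro h hh hr
    by_cases hil : i ∈ lastProfile h
    · exact (congrArg (Γ.u i) (outcomeFrom_update_of_mem hP hσ _ h hh hr hil)).le
    have hT : h.length < T := by omega
    set X := reach Γ.Wants (r + 1) (lastProfile h) with hX
    have hsub : lastProfile h ⊆ X := subset_reach _ _
    have hXX : reach Γ.Wants r X = X := reach_reach hP (Nat.le_succ r) _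
    have hXj : jointAction (reachStrategy Γ.Wants T) h = X := by
      rw [jointAction_reachStrategy, show T - h.length = r + 1 by omega]
    rw [outcomeFrom_cons _ hT]
    cases hσh : σ h with
    | true =>
      have hj : jointAction (Function.update (reachStrategy Γ.Wants T) i σ) h = insert i X := by
        rw [← hXj]
        ext j
        rw [Finset.mem_insert, mem_jointAction, mem_jointAction]
        by_cases hji : j = i
        · subst hji
          simp [hσh]
        · simp [hji]
      rw [hj, outcomeFrom_update_of_mem hP hσ r _
        (hh.cons (hsub.trans (Finset.subset_insert _ _))) (by rw [List.length_cons]; omega)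
        (Finset.mem_insert_self _ _)]
      by_cases hiX : i ∈ X
      · rw [Finset.insert_eq_of_mem hiX, lastProfile, hXX]
      · exact hΓ.le_of_not_wants hiX (subset_reach _ _) (stable_reach hP r _ i hiX)
    | false =>
      have hj : jointAction (Function.update (reachStrategy Γ.Wants T) i σ) h = X.erase i := by
        rw [← hXj]
        ext j
        rw [Finset.mem_erase, mem_jointAction, mem_jointAction]
        by_cases hji : j = i
        · subst hji
          simp [hσh]
        · simp [hji]
      rw [hj]
      refine (ih _ (hh.cons (Finset.subset_erase.2 ⟨hsub, hil⟩))
        (by rw [List.length_cons]; omega)).trans ?_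
      rw [lastProfile]
      by_cases hiX : i ∈ X
      · -- The others follow the equilibrium path, so only `i` may be missing at the end.
        have h1 : X.erase i ⊆ reach Γ.Wants r (X.erase i) := subset_reach _ _
        have h2 : reach Γ.Wants r (X.erase i) ⊆ X :=
          (reach_mono r (Finset.erase_subset _ _)).trans hXX.subset
        by_cases hir : i ∈ reach Γ.Wants r (X.erase i)
        · have : X ⊆ reach Γ.Wants r (X.erase i) := by
            intro j hj
            by_cases hji : j = i
            · exact hji ▸ hir
            · exact h1 (Finset.mem_erase.2 ⟨hji, hj⟩)
          rw [h2.antisymm this]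
        · rw [(Finset.subset_erase.2 ⟨h2, hir⟩).antisymm h1]
          exact ((StageGame.wants_of_mem hiX).1 (of_mem_reach hP hiX hil)).le
      · rw [Finset.erase_eq_of_notMem hiX, hXX]

lemma isSPNE_reachStrategy (hΓ : Γ.IsCoordination) (T : ℕ) :
    IsSPNE Γ T (reachStrategy Γ.Wants T) where
  irreversible := isIrreversible_reachStrategy _
  noDeviation h hh hT i σ hσ := by
    rw [outcomeFrom_reachStrategy hΓ.monotone_wants (T - h.length) h hh (by omega)]
    exact u_outcomeFrom_update_le hΓ hσ (T - h.length) h hh (by omega)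

/-- The players reached from nobody form the least monotone equilibrium outcome. -/
lemma isLeast_outcomes (hΓ : Γ.IsCoordination) (T : ℕ) :
    IsLeast (outcomes Γ T) (reach Γ.Wants T ∅) := by
  have hnil : IsHistory ([] : List (Finset N)) := List.Pairwise.nil
  constructor
  · exact ⟨_, isSPNE_reachStrategy hΓ T, isMonotonic_reachStrategy _,
      outcomeFrom_reachStrategy hΓ.monotone_wants T [] hnil (by simp)⟩
  · rintro Y ⟨s, hs, hm, rfl⟩
    have h := stable_outcomeFrom hΓ hs hm T [] hnil (by simp)
    exact (reach_mono T (Finset.empty_subset _)).trans h.subset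

lemma coordinationTimes_eq (hΓ : Γ.IsCoordination) (X : Finset N) :
    coordinationTimes Γ X = {T | 1 ≤ T ∧ X ⊆ reach Γ.Wants T ∅} := by
  ext T
  refine and_congr_right fun _ => ⟨fun h => h _ (isLeast_outcomes hΓ T).1, fun h Y hY => ?_⟩
  exact h.trans ((isLeast_outcomes hΓ T).2 hY)

end Equilibrium

/-! ### Strongly connected components and tree-depth -/

section Network

variable {N : Type*}

lemma ReachesIn.mono {G : Digraph N} {X Y : Finset N} (h : X ⊆ Y) {j i : N}
    (hr : ReachesIn G X j i) : ReachesIn G Y j i :=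
  Relation.ReflTransGen.mono (fun _ _ hab => ⟨h hab.1, h hab.2.1, hab.2.2⟩) _ _ hr

/-- A vertex of `X` on a closed walk through a component belongs to the component. -/
lemma IsComponent.mem_of_reachesIn {G : Digraph N} {X C : Finset N} (hC : IsComponent G X C)
    {c d e : N} (hc : c ∈ C) (he : e ∈ C) (hdX : d ∈ X) (h1 : ReachesIn G X c d)
    (h2 : ReachesIn G X d e) : d ∈ C := by
  classical
  set D := X.filter (fun d => ReachesIn G X c d ∧ ReachesIn G X d c) with hD
  have hCX : C ⊆ X := hC.prop.1
  have hsc := hC.prop.2.2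
  have hCD : C ⊆ D := fun a ha => Finset.mem_filter.2
    ⟨hCX ha, (hsc _ ha _ hc).mono hCX, (hsc _ hc _ ha).mono hCX⟩
  have key : ∀ a b, ReachesIn G X a b → ReachesIn G X c a → ReachesIn G X b c →
      ReachesIn G D a b := by
    intro a b hab
    induction hab using Relation.ReflTransGen.head_induction_on with
    | refl => exact fun _ _ => Relation.ReflTransGen.refl
    | head haa' ha'b ih =>
      intro hca hbc
      have hca' := Relation.ReflTransGen.tail hca haa'
      have ha'c := Relation.ReflTransGen.trans ha'b hbc
      exact Relation.ReflTransGen.head ⟨Finset.mem_filter.2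
        ⟨haa'.1, hca, Relation.ReflTransGen.head haa' ha'c⟩,
        Finset.mem_filter.2 ⟨haa'.2.1, hca', ha'c⟩, haa'.2.2⟩ (ih hca' hbc)
  have hDsc : StronglyConnected G D := by
    intro i hi j hj
    obtain ⟨-, hci, hic⟩ := Finset.mem_filter.1 hi
    obtain ⟨-, hcj, hjc⟩ := Finset.mem_filter.1 hj
    exact key j i (Relation.ReflTransGen.trans hjc hci) hcj hic
  refine hC.2 ⟨Finset.filter_subset _ _, ⟨c, hCD hc⟩, hDsc⟩ hCD ?_
  exact Finset.mem_filter.2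
    ⟨hdX, h1, Relation.ReflTransGen.trans h2 ((hsc _ hc _ he).mono hCX)⟩

lemma treeDepth_le_iff_of_not_stronglyConnected {G : Digraph N} {X : Finset N} (h1 : 1 < X.card)
    (hX : ¬ StronglyConnected G X) (t : ℕ) :
    treeDepth G X ≤ t ↔ ∀ C, IsComponent G X C → treeDepth G C ≤ t := by
  classical
  rw [treeDepth, dif_neg (by omega), if_neg hX, Finset.sup_le_iff]
  constructor
  · intro h C hC
    refine h ⟨C, ?_⟩ (Finset.mem_attach _ _)
    rw [Finset.mem_filter, Finset.mem_ssubsets]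
    refine ⟨hC.prop.1.ssubset_of_ne ?_, hC⟩
    rintro rfl
    exact hX hC.prop.2.2
  · rintro h ⟨C, hC⟩ -
    exact h C (Finset.mem_filter.1 hC).2

lemma treeDepth_le_iff_of_stronglyConnected [DecidableEq N] {G : Digraph N} {X : Finset N}
    (h1 : 1 < X.card) (hX : StronglyConnected G X) (t : ℕ) :
    treeDepth G X ≤ t + 1 ↔ ∃ i ∈ X, treeDepth G (X.erase i) ≤ t := by
  obtain rfl : ‹DecidableEq N› = fun a b => Classical.propDecidable (a = b) :=
    Subsingleton.elim _ _
  rw [treeDepth, dif_neg (by omega), if_pos hX, add_comm 1, Nat.add_le_add_iff_right,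
    Finset.inf'_le_iff]
  exact ⟨fun ⟨i, _, hi⟩ => ⟨i.1, i.2, hi⟩, fun ⟨i, hi, h⟩ => ⟨⟨i, hi⟩, Finset.mem_attach _ _, h⟩⟩

variable [Fintype N]

/-- Every vertex of `G|_X` lies in a strongly connected component. -/
lemma exists_isComponent (G : Digraph N) {X : Finset N} {x : N} (hx : x ∈ X) :
    ∃ C, IsComponent G X C ∧ x ∈ C := by
  have h0 : ({x} : Finset N) ⊆ X ∧ ({x} : Finset N).Nonempty ∧ StronglyConnected G {x} := by
    refine ⟨by simpa using hx, by simp, fun i hi j hj => ?_⟩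
    rw [Finset.mem_singleton.1 hi, Finset.mem_singleton.1 hj]
    exact Relation.ReflTransGen.refl
  obtain ⟨C, hC, hmax⟩ := Finite.exists_le_maximal
    (p := fun D : Finset N => D ⊆ X ∧ D.Nonempty ∧ StronglyConnected G D) h0
  exact ⟨C, hmax, hC (Finset.mem_singleton_self x)⟩

lemma one_le_treeDepth (G : Digraph N) (X : Finset N) : 1 ≤ treeDepth G X := by
  induction X using Finset.strongInduction with
  | H X ih =>
    by_cases h1 : X.card ≤ 1
    · rw [treeDepth, dif_pos h1]
    by_cases hX : StronglyConnected G X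
    · rw [treeDepth, dif_neg h1, if_pos hX]
      exact Nat.le_add_right _ _
    · by_contra h0
      obtain ⟨x, hx⟩ : X.Nonempty := Finset.card_pos.1 (by omega)
      obtain ⟨C, hC, -⟩ := exists_isComponent G hx
      have h2 := (treeDepth_le_iff_of_not_stronglyConnected (by omega) hX 0).1 (by omega) C hC
      have h3 := ih C (hC.prop.1.ssubset_of_ne (by rintro rfl; exact hX hC.prop.2.2))
      omega

/-! ### Weakest-link incentives and tree-depth -/

lemma mem_inNeighbors {G : Digraph N} {i j : N} : j ∈ inNeighbors G i ↔ G.Adj j i := by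
  simp [inNeighbors]

/-- The incentive in a weakest-link game on `G`: action `1` pays for `i` if all in-neighbours of `i`
take it. -/
def LinksActive (G : Digraph N) (i : N) (X : Finset N) : Prop :=
  inNeighbors G i ⊆ X

lemma monotone_linksActive (G : Digraph N) (i : N) : Monotone (LinksActive G i) :=
  fun _ _ hXY h => Finset.Subset.trans h hXY

variable [DecidableEq N] {G : Digraph N}

/-- Members who were not committed draw in all vertices from which they can be reached. -/
lemma mem_reach_of_reachesIn {W A : Finset N} {t : ℕ} (hWA : Disjoint W A) {j i : N}
    (h : ReachesIn G W j i) (hi : i ∈ reach (LinksActive G) t A) :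
    j ∈ reach (LinksActive G) t A := by
  induction h using Relation.ReflTransGen.head_induction_on with
  | refl => exact hi
  | head hab _ ih =>
    exact of_mem_reach (monotone_linksActive G) ih (Finset.disjoint_left.1 hWA hab.2.1)
      (mem_inNeighbors.2 hab.2.2)

/-- If the vertices of `W` depend on each other and on the committed players in `A` only, then `W` is
reached within `t` stages precisely when its tree-depth is at most `t`.  A strongly connected `W`
unravels only after one of its vertices commits unconditionally, which costs one stage and deletes
this vertex; the components of a general `W` are reached one after the other in the course of the
same stages. -/
lemma subset_reach_iff_treeDepth_le (W : Finset N) : ∀ (A : Finset N) (t : ℕ), Disjoint W A →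
    (∀ i ∈ W, inNeighbors G i ⊆ W ∪ A) → 1 ≤ t →
      (W ⊆ reach (LinksActive G) t A ↔ treeDepth G W ≤ t) := by
  have hP := monotone_linksActive G
  induction W using Finset.strongInduction with
  | H W ih =>
    intro A t hWA hcl ht
    obtain ⟨t, rfl⟩ : ∃ r, t = r + 1 := ⟨t - 1, by omega⟩
    by_cases h1 : W.card ≤ 1
    · rw [treeDepth, dif_pos h1]
      refine iff_of_true (fun i hi => ?_) ht
      have hW : W = {i} := Finset.eq_singleton_iff_unique_mem.2
        ⟨hi, fun j hj => Finset.card_le_one.1 h1 j hj i hi⟩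
      by_contra hn
      refine stable_reach hP t A i hn ((hcl i hi).trans ?_)
      rw [hW]
      refine Finset.Subset.trans ?_ (subset_reach _ _)
      rw [Finset.insert_eq]
      exact Finset.union_subset_union_right (subset_reach _ _)
    by_cases hW : StronglyConnected G W
    · rw [treeDepth_le_iff_of_stronglyConnected (by omega) hW]
      constructor
      · intro hsub
        -- Some `i ∈ W` wants to commit although nobody else in `W` has been reached yet.
        set Z := reach (LinksActive G) (t + 1) A \ W with hZ
        have hAZ : A ⊆ Z := fun a ha => Finset.mem_sdiff.2
          ⟨subset_reach _ _ ha, fun h => Finset.disjoint_left.1 hWA h ha⟩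
        have hns : ¬ Stable (LinksActive G) t Z := by
          intro hs
          obtain ⟨w, hw⟩ : W.Nonempty := Finset.card_pos.1 (by omega)
          exact (Finset.mem_sdiff.1 (reach_subset_of_stable hAZ hs (hsub hw))).2 hw
        unfold Stable at hns
        push Not at hns
        obtain ⟨i, hiZ, hPi⟩ := hns
        have hiW : i ∈ W := by
          by_contra hiW
          have hi : i ∉ reach (LinksActive G) (t + 1) A :=
            fun h => hiZ (Finset.mem_sdiff.2 ⟨h, hiW⟩)
          exact stable_reach hP t A i hi (hP i (reach_mono t
            (Finset.insert_subset_insert i Finset.sdiff_subset)) hPi)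
        have hWr : W ⊆ reach (LinksActive G) t (insert i Z) := by
          intro j hj
          have hji := hW i hiW j hj
          have hdis : Disjoint (W.erase i) (insert i Z) := by
            rw [Finset.disjoint_left]
            intro a ha ha'
            rw [Finset.mem_erase] at ha
            rcases Finset.mem_insert.1 ha' with rfl | h
            · exact ha.1 rfl
            · exact (Finset.mem_sdiff.1 h).2 ha.2
          induction hji using Relation.ReflTransGen.head_induction_on with
          | refl => exact subset_reach _ _ (Finset.mem_insert_self _ _)
          | @head a b hab _ ih' =>
            by_cases hbi : b = i
            · exact hPi (mem_inNeighbors.2 (hbi ▸ hab.2.2))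
            · exact of_mem_reach hP (ih' hab.2.1)
                (Finset.disjoint_left.1 hdis (Finset.mem_erase.2 ⟨hbi, hab.2.1⟩))
                (mem_inNeighbors.2 hab.2.2)
        refine ⟨i, hiW, ?_⟩
        rcases Nat.eq_zero_or_pos t with rfl | ht0
        · exfalso
          have hWi : ∀ j ∈ W, j = i := fun j hj =>
            (Finset.mem_insert.1 (hWr hj)).resolve_right fun h => (Finset.mem_sdiff.1 h).2 hj
          exact h1 (Finset.card_le_one.2 fun a ha b hb => (hWi a ha).trans (hWi b hb).symm)
        · refine (ih _ (Finset.erase_ssubset hiW) (insert i Z) t ?_ ?_ ht0).1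
            ((Finset.erase_subset _ _).trans hWr)
          · rw [Finset.disjoint_left]
            intro a ha ha'
            rw [Finset.mem_erase] at ha
            rcases Finset.mem_insert.1 ha' with rfl | h
            · exact ha.1 rfl
            · exact (Finset.mem_sdiff.1 h).2 ha.2
          · intro j hj a ha
            have := hcl j (Finset.mem_of_mem_erase hj) ha
            simp only [Finset.mem_union, Finset.mem_erase, Finset.mem_insert] at this ⊢
            rcases this with h | h
            · tauto
            · exact Or.inr (Or.inr (hAZ h))
      · rintro ⟨i, hi, htd⟩
        have ht0 : 1 ≤ t := (one_le_treeDepth G _).trans htd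
        set X := reach (LinksActive G) (t + 1) A with hX
        have hsub : W.erase i ⊆ reach (LinksActive G) t (insert i A) := by
          refine (ih _ (Finset.erase_ssubset hi) (insert i A) t ?_ ?_ ht0).2 htd
          · rw [Finset.disjoint_left]
            intro a ha ha'
            rw [Finset.mem_erase] at ha
            rcases Finset.mem_insert.1 ha' with rfl | h
            · exact ha.1 rfl
            · exact Finset.disjoint_left.1 hWA ha.2 h
          · intro j hj a ha
            have := hcl j (Finset.mem_of_mem_erase hj) ha
            simp only [Finset.mem_union, Finset.mem_erase, Finset.mem_insert] at this ⊢
            tauto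
        have hins : insert i A ⊆ reach (LinksActive G) t (insert i A) := subset_reach _ _
        have hall : W ∪ A ⊆ reach (LinksActive G) t (insert i A) := by
          refine Finset.union_subset ?_ ((Finset.subset_insert _ _).trans hins)
          rw [← Finset.insert_erase hi]
          exact Finset.insert_subset (hins (Finset.mem_insert_self _ _)) hsub
        have hiX : i ∈ X := by
          by_contra hiX
          exact stable_reach hP t A i hiX (((hcl i hi).trans hall).trans (reach_mono t
            (Finset.insert_subset_insert i (subset_reach _ _))))
        exact (Finset.subset_union_left.trans hall).trans
          (reach_subset_reach hP (Nat.le_succ t) (Finset.insert_subset hiX (subset_reach _ _)))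
    · rw [treeDepth_le_iff_of_not_stronglyConnected (by omega) hW]
      have hss : ∀ C, IsComponent G W C → C ⊂ W := fun C hC =>
        hC.prop.1.ssubset_of_ne (by rintro rfl; exact hW hC.prop.2.2)
      constructor
      · intro hsub C hC
        refine (ih C (hss C hC) (A ∪ W \ C) (t + 1) ?_ ?_ ht).1
          ((hC.prop.1.trans hsub).trans (reach_mono _ Finset.subset_union_left))
        · rw [Finset.disjoint_union_right]
          exact ⟨hWA.mono_left hC.prop.1, Finset.disjoint_sdiff⟩
        · intro j hj a ha
          have := hcl j (hC.prop.1 hj) ha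
          simp only [Finset.mem_union, Finset.mem_sdiff] at this ⊢
          tauto
      · intro h
        set X := reach (LinksActive G) (t + 1) A with hX
        by_contra hWX
        -- An unreached vertex with as few ancestors as possible lies in a component all of whose
        -- remaining links are already active.
        classical
        let anc : N → Finset N := fun j => W.filter (fun d => ReachesIn G W d j)
        obtain ⟨j, hj, hmin⟩ := Finset.exists_min_image (W \ X) (fun j => (anc j).card)
          (Finset.sdiff_nonempty.2 hWX)
        obtain ⟨hjW, hjX⟩ := Finset.mem_sdiff.1 hj
        obtain ⟨C, hC, hjC⟩ := exists_isComponent G hjW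
        have hCW := hC.prop.1
        have hCX : Disjoint C X := Finset.disjoint_left.2 fun c hc hcX =>
          hjX (mem_reach_of_reachesIn hWA ((hC.prop.2.2 c hc j hjC).mono hCW) hcX)
        have hCcl : ∀ c ∈ C, inNeighbors G c ⊆ C ∪ X := by
          intro c hc a ha
          by_cases haX : a ∈ X
          · exact Finset.mem_union_right _ haX
          have haW : a ∈ W := by
            rcases Finset.mem_union.1 (hcl c (hCW hc) ha) with h | h
            · exact h
            · exact absurd (subset_reach _ _ h) haX
          have hac : ReachesIn G W a c :=
            Relation.ReflTransGen.single ⟨haW, hCW hc, mem_inNeighbors.1 ha⟩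
          have haj : ReachesIn G W a j :=
            Relation.ReflTransGen.trans hac ((hC.prop.2.2 j hjC c hc).mono hCW)
          have hsub : anc a ⊆ anc j := fun d hd => Finset.mem_filter.2
            ⟨(Finset.mem_filter.1 hd).1, Relation.ReflTransGen.trans (Finset.mem_filter.1 hd).2 haj⟩
          have heq := Finset.eq_of_subset_of_card_le hsub
            (hmin a (Finset.mem_sdiff.2 ⟨haW, haX⟩))
          have hja : j ∈ anc a := heq ▸ Finset.mem_filter.2 ⟨hjW, Relation.ReflTransGen.refl⟩
          exact Finset.mem_union_left _
            (hC.mem_of_reachesIn hjC hc haW (Finset.mem_filter.1 hja).2 hac)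
        have hCr := (ih C (hss C hC) X (t + 1) hCX hCcl ht).2 (h C hC)
        exact hjX ((reach_reach hP le_rfl A).subset (hCr hjC))

lemma subset_reach_empty_iff (X : Finset N) {t : ℕ} (ht : 1 ≤ t) :
    X ⊆ reach (LinksActive G) t ∅ ↔ treeDepth G (ancestors G X) ≤ t := by
  have hmem : ∀ j, j ∈ ancestors G X ↔ ∃ i ∈ X, Relation.ReflTransGen G.Adj j i := by
    simp [ancestors]
  rw [← subset_reach_iff_treeDepth_le (ancestors G X) ∅ t (Finset.disjoint_empty_right _) ?_ ht]
  · constructor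
    · intro h j hj
      obtain ⟨i, hi, hji⟩ := (hmem j).1 hj
      refine mem_reach_of_reachesIn (W := Finset.univ) (Finset.disjoint_empty_right _) ?_ (h hi)
      exact Relation.ReflTransGen.mono
        (fun _ _ hab => ⟨Finset.mem_univ _, Finset.mem_univ _, hab⟩) _ _ hji
    · exact fun h i hi => h ((hmem i).2 ⟨i, hi, Relation.ReflTransGen.refl⟩)
  · intro i hi a ha
    obtain ⟨x, hx, hix⟩ := (hmem i).1 hi
    exact Finset.mem_union_left _
      ((hmem a).2 ⟨x, hx, Relation.ReflTransGen.head (mem_inNeighbors.1 ha) hix⟩)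

end Network

/-! ### Sufficient networks and weakest-link games -/

section Sufficient

variable {N : Type*} [Fintype N] [DecidableEq N]

lemma IsSufficient.wants_of_linksActive {Γ : StageGame N} (hΓ : Γ.IsCoordination)
    {S : Digraph N} (hS : IsSufficient Γ S) (i : N) (X : Finset N) (h : LinksActive S i X) :
    Γ.Wants i X := by
  refine hΓ.monotone_wants i h ?_
  rw [StageGame.wants_of_notMem fun hi => hS.1 i (mem_inNeighbors.1 hi)]
  exact hS.2 i

/-- The network whose in-neighbourhoods are inclusion-minimal sets on which the players are willing to
act is a minimal sufficient network. -/
lemma isMinimalSufficient_of_minimal {Γ : StageGame N} {G : Digraph N}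
    (hG : ∀ i, Minimal (Γ.Wants i) (inNeighbors G i)) : IsMinimalSufficient Γ G := by
  have hloop : NoLoops G := fun i hi =>
    Finset.notMem_erase i (inNeighbors G i)
      ((hG i).2 (StageGame.wants_erase.2 (hG i).1) (Finset.erase_subset _ _)
        (mem_inNeighbors.2 hi))
  refine ⟨⟨hloop, fun i => ?_⟩, fun S hS hSG a i hai => ?_⟩
  · exact (StageGame.wants_of_notMem fun hi => hloop i (mem_inNeighbors.1 hi)).1 (hG i).1
  · have hw : Γ.Wants i (inNeighbors S i) :=
      (StageGame.wants_of_notMem fun hi => hS.1 i (mem_inNeighbors.1 hi)).2 (hS.2 i)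
    have hle : inNeighbors S i ⊆ inNeighbors G i :=
      fun b hb => mem_inNeighbors.2 (hSG (mem_inNeighbors.1 hb))
    exact mem_inNeighbors.1 ((hG i).2 hw hle (mem_inNeighbors.2 hai))

/-- There is a minimal sufficient network on which coordination is no slower than in `Γ`, whatever
the number of stages. -/
lemma exists_network {Γ : StageGame N} (hΓ : Γ.IsCoordination) (hnd : Γ.NonDegenerate) :
    ∃ G : Digraph N, IsMinimalSufficient Γ G ∧
      ∀ t, reach (LinksActive G) t ∅ = reach Γ.Wants t ∅ := by
  have hU : ∀ i, Γ.Wants i Finset.univ := fun i =>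
    (StageGame.wants_of_mem (Finset.mem_univ i)).2 (hnd i).1
  obtain ⟨E, hE, hEQ⟩ := exists_support hΓ.monotone_wants hU
  choose M hM hMmin using fun i => Finite.exists_le_minimal (hE i)
  let G : Digraph N := ⟨fun j i => j ∈ M i⟩
  have hGM : ∀ i, inNeighbors G i = M i := fun i => by
    ext j
    rw [mem_inNeighbors]
  have hG : IsMinimalSufficient Γ G :=
    isMinimalSufficient_of_minimal fun i => (hGM i).symm ▸ hMmin i
  refine ⟨G, hG, fun t => subset_antisymm ?_ ?_⟩
  · exact reach_mono_pred hΓ.monotone_wants (hG.1.wants_of_linksActive hΓ) t ∅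
  · exact hEQ _ (monotone_linksActive G) (fun i => (hGM i).subset.trans (hM i)) t

open Classical in
/-- The weakest-link game on `G` in which action `0` is worth nothing, and action `1` is worth `1`
if all in-neighbours take it and `-1` otherwise. -/
noncomputable def weakestLinkGame (G : Digraph N) : StageGame N where
  u i X := if i ∈ X then (if inNeighbors G i ⊆ X then 1 else -1) else 0

variable {G : Digraph N}

lemma u_weakestLinkGame_of_notMem {i : N} {X : Finset N} (h : i ∉ X) :
    (weakestLinkGame G).u i X = 0 := by
  simp [weakestLinkGame, h]

lemma u_weakestLinkGame_insert_of_subset {i : N} {X : Finset N} (h : inNeighbors G i ⊆ X) :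
    (weakestLinkGame G).u i (insert i X) = 1 := by
  simp [weakestLinkGame, h.trans (Finset.subset_insert i X)]

lemma u_weakestLinkGame_insert_of_not_subset (hG : NoLoops G) {i : N} {X : Finset N}
    (h : ¬ inNeighbors G i ⊆ X) : (weakestLinkGame G).u i (insert i X) = -1 := by
  have : ¬ inNeighbors G i ⊆ insert i X := by
    rwa [Finset.subset_insert_iff_of_notMem fun hi => hG i (mem_inNeighbors.1 hi)]
  simp [weakestLinkGame, this]

lemma isCoordination_weakestLinkGame (hG : NoLoops G) : (weakestLinkGame G).IsCoordination := by
  constructor <;> intro i X Y hiY hXY <;>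
    have hX0 := u_weakestLinkGame_of_notMem (G := G) fun h => hiY (hXY.1 h) <;>
    have hY0 := u_weakestLinkGame_of_notMem (G := G) hiY <;>
    by_cases hY : inNeighbors G i ⊆ Y
  · simp [u_weakestLinkGame_insert_of_subset hY, hY0]
  · simp [u_weakestLinkGame_insert_of_not_subset hG fun h => hY (h.trans hXY.1), hX0]
  · have hY1 := u_weakestLinkGame_insert_of_subset hY
    by_cases hX : inNeighbors G i ⊆ X
    · simp [StageGame.bestValue, u_weakestLinkGame_insert_of_subset hX, hX0, hY0, hY1]
    · simp [StageGame.bestValue, u_weakestLinkGame_insert_of_not_subset hG hX, hX0, hY0, hY1]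
  · have hY1 := u_weakestLinkGame_insert_of_not_subset hG hY
    simp [StageGame.bestValue,
      u_weakestLinkGame_insert_of_not_subset hG fun h => hY (h.trans hXY.1), hX0, hY0, hY1]
  · simp [u_weakestLinkGame_insert_of_subset hY, hY0]
  · simp [u_weakestLinkGame_insert_of_not_subset hG hY, hX0]

lemma isWeakestLink_weakestLinkGame (hG : NoLoops G) : IsWeakestLink (weakestLinkGame G) G where
  isCoordination := isCoordination_weakestLinkGame hG
  noLoops := hG
  better i X hi h := by
    rw [u_weakestLinkGame_of_notMem hi, u_weakestLinkGame_insert_of_subset h]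
    norm_num
  worse i X hi h := by
    rw [u_weakestLinkGame_of_notMem hi, u_weakestLinkGame_insert_of_not_subset hG h]
    norm_num

lemma IsWeakestLink.wants_iff {Λ : StageGame N} (hΛ : IsWeakestLink Λ G) (i : N)
    (X : Finset N) : Λ.Wants i X ↔ LinksActive G i X := by
  have hE : inNeighbors G i ⊆ X ↔ inNeighbors G i ⊆ X.erase i :=
    ⟨fun h => Finset.subset_erase.2 ⟨h, fun hi => hΛ.noLoops i (mem_inNeighbors.1 hi)⟩,
      fun h => h.trans (Finset.erase_subset _ _)⟩
  rw [← StageGame.wants_erase, StageGame.wants_of_notMem (Finset.notMem_erase _ _), LinksActive, hE]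
  constructor
  · intro h
    by_contra hn
    exact lt_asymm h (hΛ.worse i _ (Finset.notMem_erase _ _) hn)
  · exact hΛ.better i _ (Finset.notMem_erase _ _)

lemma IsWeakestLink.nonDegenerate {Λ : StageGame N} (hΛ : IsWeakestLink Λ G)
    (hne : ∀ i, (inNeighbors G i).Nonempty) : Λ.NonDegenerate := by
  intro i
  constructor
  · rw [← StageGame.wants_of_mem (Finset.mem_univ i), hΛ.wants_iff]
    exact Finset.subset_univ _
  · have := hΛ.worse i ∅ (Finset.notMem_empty i)
      fun h => (hne i).ne_empty (Finset.subset_empty.1 h)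
    simpa using this

lemma IsSufficient.nonempty_inNeighbors {Γ : StageGame N} (hnd : Γ.NonDegenerate)
    (hG : IsSufficient Γ G) (i : N) : (inNeighbors G i).Nonempty := by
  rw [Finset.nonempty_iff_ne_empty]
  intro h
  have := hG.2 i
  rw [h] at this
  exact lt_asymm this (by simpa using (hnd i).2)

lemma coordinationTimes_eq_of_reach_eq {Γ : StageGame N} (hΓ : Γ.IsCoordination)
    (h : ∀ t, reach (LinksActive G) t ∅ = reach Γ.Wants t ∅) (X : Finset N) :
    coordinationTimes Γ X = Set.Ici (treeDepth G (ancestors G X)) := by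
  rw [coordinationTimes_eq hΓ]
  ext T
  rw [Set.mem_ofPred_eq, Set.mem_Ici, ← h]
  constructor
  · exact fun ⟨h1, h2⟩ => (subset_reach_empty_iff X h1).1 h2
  · intro hT
    have h1 := (one_le_treeDepth G _).trans hT
    exact ⟨h1, (subset_reach_empty_iff X h1).2 hT⟩

end Sufficient

end Coordination

theorem mainTheorem5 {N : Type*} [Fintype N] [DecidableEq N]
    (Γ : Coordination.StageGame N) (hΓ : Γ.IsCoordination) (hnd : Γ.NonDegenerate) :
    (∃ (G : Digraph N) (Λ : Coordination.StageGame N),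
      Coordination.IsMinimalSufficient Γ G ∧
      Coordination.IsWeakestLink Λ G ∧ Λ.NonDegenerate ∧
      ∀ X : Finset N,
        (Coordination.coordinationTimes Γ X).Nonempty ∧
        (Coordination.coordinationTimes Λ X).Nonempty ∧
        Coordination.tau Γ X = Coordination.tau Λ X ∧
        Coordination.tau Λ X = Coordination.treeDepth G (Coordination.ancestors G X)) ∧
    (∀ X : Finset N,
      IsLeast {d : ℕ | ∃ S : Digraph N, Coordination.IsMinimalSufficient Γ S ∧
          d = Coordination.treeDepth S (Coordination.ancestors S X)}
        (Coordination.tau Γ X)) := by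
  obtain ⟨G, hG, hGr⟩ := Coordination.exists_network hΓ hnd
  have hΛ := Coordination.isWeakestLink_weakestLinkGame hG.1.1
  have hΛr : ∀ t, Coordination.reach (Coordination.LinksActive G) t ∅ =
      Coordination.reach (Coordination.weakestLinkGame G).Wants t ∅ := fun t => by
    congr
    ext i X
    exact (hΛ.wants_iff i X).symm
  have hTΓ := Coordination.coordinationTimes_eq_of_reach_eq hΓ hGr
  have hTΛ := Coordination.coordinationTimes_eq_of_reach_eq hΛ.isCoordination hΛr
  have hτΓ : ∀ X, Coordination.tau Γ X =
      Coordination.treeDepth G (Coordination.ancestors G X) := fun X => by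
    rw [Coordination.tau, hTΓ, csInf_Ici]
  have hτΛ : ∀ X, Coordination.tau (Coordination.weakestLinkGame G) X =
      Coordination.treeDepth G (Coordination.ancestors G X) := fun X => by
    rw [Coordination.tau, hTΛ, csInf_Ici]
  refine ⟨⟨G, Coordination.weakestLinkGame G, hG, hΛ,
    hΛ.nonDegenerate (hG.1.nonempty_inNeighbors hnd), fun X => ⟨?_, ?_, ?_, hτΛ X⟩⟩,
    fun X => ⟨⟨G, hG, hτΓ X⟩, ?_⟩⟩
  · rw [hTΓ]
    exact Set.nonempty_Ici
  · rw [hTΛ]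
    exact Set.nonempty_Ici
  · rw [hτΓ, hτΛ]
  · -- The links of a sufficient network only give a part of the incentives in `Γ`.
    rintro d ⟨S, hS, rfl⟩
    refine Nat.sInf_le ?_
    have h1 := Coordination.one_le_treeDepth S (Coordination.ancestors S X)
    rw [Coordination.coordinationTimes_eq hΓ]
    exact ⟨h1, ((Coordination.subset_reach_empty_iff X h1).2 le_rfl).trans
      (Coordination.reach_mono_pred hΓ.monotone_wants (hS.1.wants_of_linksActive hΓ) _ ∅)⟩
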